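/- **Theorem 9.1 (Non-commutative Hausdorff–Young theorem).** For $x,y\in\mathbb R$ let $T_x$ and $M_y$ be the translation and modulation operators on $L^2(\mathbb R)$, $(T_xs)(t)=s(t-x)$ and $(M_ys)(t)=e^{-2\pi iyt}s(t)$. For $f\in L^1(\mathbb R^2)$ let $$\Theta(f)=\iint f(x,y)\,M_{-y}T_{-x}\,dx\,dy$$ be its inverse Alpha transform, the bounded operator on $L^2(\mathbb R)$ given by $\Theta(f)s=\iint f(x,y)\,M_{-y}T_{-x}s\,dx\,dy$ for $s\in L^2(\mathbb R)$. For $1\le q<\infty$ let $S^q$ be the Schatten class of bounded operators $A$ on $L^2(\mathbb R)$ with $\|A\|_{S^q}=(\operatorname{tr}|A|^q)^{1/q}<\infty$, where $|A|=(A^*A)^{1/2}$, and let $S^\infty$ be the space of compact operators on $L^2(\mathbb R)$ with the operator norm. Let $1\le p\le 2$ and $p^{-1}+p'^{-1}=1$ (so $p'=\infty$ if $p=1$). Then $\Theta$ extends to a bounded operator $$\Theta: L^p(\mathbb R^2)\to S^{p'}.$$ That is, there are a linear map $\Theta_p$ from $L^p(\mathbb R^2)$ to the bounded operators on $L^2(\mathbb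 R)$ and a constant $C<\infty$ such that $\Theta_p(f)=\Theta(f)$ for all $f\in L^1(\mathbb R^2)\cap L^p(\mathbb R^2)$, and $\Theta_p(f)\in S^{p'}$ and $\|\Theta_p(f)\|_{S^{p'}}\le C\|f\|_p$ for all $f\in L^p(\mathbb R^2)$. -/

import Mathlib

open MeasureTheory ComplexConjugate
open scoped ENNReal NNReal InnerProductSpace

noncomputable section

namespace AlphaTransform

/-! ## Schatten classes on a complex Hilbert space -/

section Schatten

variable {E : Type*} [NormedAddCommGroup E] [InnerProductSpace ℂ E]

/-- Parseval's identity with values in `[0, ∞]`. -/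
theorem tsum_inner_sq {ι : Type*} (b : HilbertBasis ι ℂ E) (v : E) :
    ∑' i, ENNReal.ofReal (‖⟪b i, v⟫_ℂ‖ ^ 2) = ENNReal.ofReal (‖v‖ ^ 2) := by
  have h := b.hasSum_inner_mul_inner v v
  have h2 := (Complex.hasSum_re h)
  have h3 : (fun i => (⟪v, b i⟫_ℂ * ⟪b i, v⟫_ℂ).re) = fun i => ‖⟪b i, v⟫_ℂ‖ ^ 2 := by
    funext i
    rw [← inner_conj_symm v (b i), mul_comm, Complex.mul_conj, Complex.normSq_eq_norm_sq,
      Complex.ofReal_re]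
  have h4 : (⟪v, v⟫_ℂ).re = ‖v‖ ^ 2 := by
    rw [inner_self_eq_norm_sq_to_K (𝕜 := ℂ)]
    norm_cast
  rw [h3, h4] at h2
  rw [← h2.tsum_eq, ENNReal.ofReal_tsum_of_nonneg (fun _ => by positivity) h2.summable]

variable [CompleteSpace E]

variable (E) in
/-- The index set of a fixed orthonormal (Hilbert) basis of `E`. -/
def basisIndex : Set E := (exists_hilbertBasis ℂ E).choose

variable (E) in
/-- A fixed orthonormal (Hilbert) basis of `E`. -/
def basis : HilbertBasis (basisIndex E) ℂ E := (exists_hilbertBasis ℂ E).choose_spec.choose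

/-- The trace `∑ᵢ ⟨eᵢ, T eᵢ⟩ ∈ [0, ∞]` of a positive operator `T`, computed in the orthonormal basis
`basis E`. By `posTrace_eq` below, every orthonormal basis gives the same value. -/
def posTrace (T : E →L[ℂ] E) : ℝ≥0∞ :=
  ∑' i, ENNReal.ofReal (⟪basis E i, T (basis E i)⟫_ℂ).re

theorem tsum_inner_star_mul_self (S : E →L[ℂ] E) {ι κ : Type*} (b : HilbertBasis ι ℂ E)
    (c : HilbertBasis κ ℂ E) :
    ∑' i, ENNReal.ofReal (⟪b i, (star S * S) (b i)⟫_ℂ).re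
      = ∑' j, ENNReal.ofReal (‖(ContinuousLinearMap.adjoint S) (c j)‖ ^ 2) := by
  have key : ∀ v : E, (⟪v, (star S * S) v⟫_ℂ).re = ‖S v‖ ^ 2 := by
    intro v
    rw [ContinuousLinearMap.star_eq_adjoint, mul_apply_eq_comp,
      ContinuousLinearMap.adjoint_inner_right, inner_self_eq_norm_sq_to_K (𝕜 := ℂ)]
    norm_cast
  have adj : ∀ v w : E, ‖⟪v, S w⟫_ℂ‖ = ‖⟪w, (ContinuousLinearMap.adjoint S) v⟫_ℂ‖ := by
    intro v w
    rw [ContinuousLinearMap.adjoint_inner_right, norm_inner_symm]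
  simp_rw [key, ← tsum_inner_sq c (S _), adj]
  rw [ENNReal.tsum_comm]
  simp_rw [tsum_inner_sq b]

/-- The trace of a positive operator does not depend on the orthonormal basis. -/
theorem posTrace_eq {T : E →L[ℂ] E} (hT : T.IsPositive) {ι : Type*} (b : HilbertBasis ι ℂ E) :
    posTrace T = ∑' i, ENNReal.ofReal (⟪b i, T (b i)⟫_ℂ).re := by
  have hT' : 0 ≤ T := (ContinuousLinearMap.nonneg_iff_isPositive T).2 hT
  obtain ⟨S, rfl⟩ := CStarAlgebra.nonneg_iff_eq_star_mul_self.1 hT'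
  rw [posTrace, tsum_inner_star_mul_self S (basis E) (basis E),
    tsum_inner_star_mul_self S b (basis E)]

/-- The Schatten norm of exponent `q ∈ [1, ∞]`, with values in `[0, ∞]`: it is `tr(|A|^q)^(1/q)` for
`q < ∞`, where `|A| = (A* A)^(1/2)`, and the operator norm for `q = ∞`. -/
def schattenNorm (q : ℝ≥0∞) (A : E →L[ℂ] E) : ℝ≥0∞ :=
  if q = ∞ then ‖A‖ₑ else posTrace (CFC.abs A ^ q.toReal) ^ (1 / q.toReal)

/-- Membership in the Schatten class of exponent `q ∈ [1, ∞]`: the bounded operators `A` with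
`tr(|A|^q) < ∞` if `q < ∞`, and the compact operators if `q = ∞`. -/
def MemSchatten (q : ℝ≥0∞) (A : E →L[ℂ] E) : Prop :=
  if q = ∞ then IsCompactOperator A else schattenNorm q A < ∞

end Schatten

/-! ## Translations, modulations and the inverse Alpha transform -/

/-- The Hilbert space `L²(ℝ)`. -/
abbrev L2 : Type := Lp ℂ 2 (volume : Measure ℝ)

/-- Translation, `(T_x s)(t) = s(t - x)`, as an isometry of `L²(ℝ)`. -/
def translation (x : ℝ) : L2 →ₗᵢ[ℂ] L2 :=
  Lp.compMeasurePreservingₗᵢ ℂ (fun t : ℝ => t - x) (measurePreserving_sub_right volume x)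

/-- The function `t ↦ exp(-2πiyt)`. -/
def char (y t : ℝ) : ℂ := Complex.exp (-2 * Real.pi * Complex.I * y * t)

theorem norm_char (y t : ℝ) : ‖char y t‖ = 1 := by
  have : (-2 * Real.pi * Complex.I * y * t : ℂ) = ((-2 * Real.pi * y * t : ℝ) : ℂ) * Complex.I := by
    push_cast
    ring
  rw [char, this, Complex.norm_exp_ofReal_mul_I]

theorem continuous_char : Continuous fun z : ℝ × ℝ => char z.1 z.2 := by
  unfold char
  fun_prop

theorem memLp_char_mul (y : ℝ) (s : L2) : MemLp (fun t => char y t * s t) 2 volume := by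
  refine MemLp.of_le (Lp.memLp s) ?_ ?_
  · exact (continuous_char.comp (Continuous.prodMk_right y)).aestronglyMeasurable.mul
      (Lp.aestronglyMeasurable s)
  · exact Filter.Eventually.of_forall fun t => by simp [norm_char]

/-- Modulation, `(M_y s)(t) = exp(-2πiyt) s(t)`, as an isometry of `L²(ℝ)`. -/
def modulation (y : ℝ) : L2 →ₗᵢ[ℂ] L2 where
  toFun s := (memLp_char_mul y s).toLp
  map_add' s t := by
    rw [← MemLp.toLp_add, MemLp.toLp_eq_toLp_iff]
    filter_upwards [Lp.coeFn_add s t] with v hv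
    simp only [hv, Pi.add_apply, mul_add]
  map_smul' c s := by
    rw [RingHom.id_apply, ← MemLp.toLp_const_smul, MemLp.toLp_eq_toLp_iff]
    filter_upwards [Lp.coeFn_smul c s] with v hv
    simp only [hv, Pi.smul_apply, smul_eq_mul]
    ring
  norm_map' s := by
    show ‖(memLp_char_mul y s).toLp‖ = ‖s‖
    rw [Lp.norm_toLp, Lp.norm_def]
    congr 1
    exact eLpNorm_congr_norm_ae (Filter.Eventually.of_forall fun t => by simp [norm_char])

theorem continuous_translation (s : L2) : Continuous fun x => translation x s := by
  let g : ℝ → C(ℝ, ℝ) := fun x => ⟨fun t => t - x, by fun_prop⟩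
  have hg : Continuous g :=
    ContinuousMap.continuous_of_continuous_uncurry _
      (show Continuous fun z : ℝ × ℝ => z.2 - z.1 by fun_prop)
  exact Continuous.compMeasurePreservingLp (f := fun _ : ℝ => s) (g := g) continuous_const hg
    (fun x => measurePreserving_sub_right volume x) (by norm_num)

theorem coeFn_modulation (y : ℝ) (s : L2) :
    (modulation y s : ℝ → ℂ) =ᵐ[volume] fun t => char y t * s t :=
  (memLp_char_mul y s).coeFn_toLp

theorem coeFn_translation (x : ℝ) (s : L2) :
    (translation x s : ℝ → ℂ) =ᵐ[volume] fun t => s (t - x) :=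
  Lp.coeFn_compMeasurePreserving s (measurePreserving_sub_right volume x)

theorem continuous_modulation (s : L2) : Continuous fun y => modulation y s := by
  have hs : Integrable (fun t => ‖s t‖ ^ 2) volume := (Lp.memLp s).integrable_norm_pow (by norm_num)
  rw [continuous_iff_continuousAt]
  intro y₀
  have hnorm : ∀ y, ‖modulation y s - modulation y₀ s‖ ^ 2
      = ∫ t, ‖(char y t - char y₀ t) * s t‖ ^ 2 := by
    intro y
    have h := congrArg Complex.re
      (L2.inner_def (𝕜 := ℂ) (modulation y s - modulation y₀ s) (modulation y s - modulation y₀ s))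
    rw [inner_self_eq_norm_sq_to_K (𝕜 := ℂ)] at h
    have h' : ∫ t, ⟪(modulation y s - modulation y₀ s : L2) t,
        (modulation y s - modulation y₀ s : L2) t⟫_ℂ
        = ((∫ t, ‖(char y t - char y₀ t) * s t‖ ^ 2 : ℝ) : ℂ) := by
      rw [← integral_complex_ofReal]
      refine integral_congr_ae ?_
      filter_upwards [Lp.coeFn_sub (modulation y s) (modulation y₀ s), coeFn_modulation y s,
        coeFn_modulation y₀ s] with t h1 h2 h3
      rw [inner_self_eq_norm_sq_to_K (𝕜 := ℂ), h1, Pi.sub_apply, h2, h3, sub_mul]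
      norm_cast
    rw [h'] at h
    exact_mod_cast h
  have hcont : Continuous fun y => ∫ t, ‖(char y t - char y₀ t) * s t‖ ^ 2 := by
    refine continuous_of_dominated (bound := fun t => 4 * ‖s t‖ ^ 2) ?_ ?_ (hs.const_mul 4) ?_
    · intro y
      refine AEStronglyMeasurable.pow (AEStronglyMeasurable.norm ?_) 2
      exact (((continuous_char.comp (Continuous.prodMk_right y)).sub
        (continuous_char.comp (Continuous.prodMk_right y₀))).aestronglyMeasurable).mul
          (Lp.aestronglyMeasurable s)
    · intro y
      refine Filter.Eventually.of_forall fun t => ?_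
      have h1 : ‖char y t - char y₀ t‖ ≤ 2 := by
        refine (norm_sub_le _ _).trans ?_
        rw [norm_char, norm_char]
        norm_num
      rw [Real.norm_of_nonneg (by positivity), norm_mul, mul_pow]
      have h2 : ‖char y t - char y₀ t‖ ^ 2 ≤ 2 ^ 2 := by gcongr
      nlinarith [sq_nonneg ‖s t‖]
    · refine Filter.Eventually.of_forall fun t => ?_
      have : Continuous fun y => char y t := continuous_char.comp (Continuous.prodMk_left t)
      fun_prop
  have h0 := hcont.tendsto y₀
  simp only [sub_self, zero_mul, norm_zero, ne_eq, OfNat.ofNat_ne_zero, not_false_eq_true, zero_pow,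
    integral_zero, ← hnorm] at h0
  rw [ContinuousAt, tendsto_iff_norm_sub_tendsto_zero]
  have h1 := h0.sqrt
  simpa [Real.sqrt_sq (norm_nonneg _)] using h1

/-- The unitary operators `M_{-y} T_{-x}` are strongly continuous in `(x, y)`. -/
theorem continuous_modulation_translation (s : L2) :
    Continuous fun z : ℝ × ℝ => modulation (-z.2) (translation (-z.1) s) := by
  have h : Continuous fun w : L2 × ℝ => modulation w.2 w.1 :=
    continuous_prod_of_continuous_lipschitzWith _ 1 continuous_modulation
      (fun y => (modulation y).lipschitz)
  have h1 : Continuous fun z : ℝ × ℝ => translation (-z.1) s :=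
    Continuous.comp' (continuous_translation s) continuous_fst.neg
  have h2 : Continuous fun z : ℝ × ℝ => -z.2 := continuous_snd.neg
  have h3 : Continuous fun z : ℝ × ℝ => ((translation (-z.1) s, -z.2) : L2 × ℝ) := h1.prodMk h2
  have h4 := Continuous.comp' h h3
  exact h4

theorem integrable_smul_modulation_translation {f : ℝ × ℝ → ℂ} (hf : Integrable f) (s : L2) :
    Integrable fun z : ℝ × ℝ => f z • modulation (-z.2) (translation (-z.1) s) := by
  have hm : AEStronglyMeasurable
      (fun z : ℝ × ℝ => f z • modulation (-z.2) (translation (-z.1) s)) volume :=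
    AEStronglyMeasurable.smul hf.aestronglyMeasurable
      (Continuous.aestronglyMeasurable (continuous_modulation_translation s))
  refine Integrable.mono (hf.norm.mul_const ‖s‖) hm (Filter.Eventually.of_forall fun z => ?_)
  simp only [norm_smul, LinearIsometry.norm_map, norm_mul, norm_norm, le_refl]

/-- The inverse Alpha transform `Θ(f) = ∬ f(x, y) M_{-y} T_{-x} dx dy` of an integrable function `f`
on `ℝ²`, a bounded operator on `L²(ℝ)`. The integral is taken in the strong operator topology: for
each `s`, the vector `Θ(f) s` is the Bochner integral of `f(x, y) M_{-y} T_{-x} s` in `L²(ℝ)`. -/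
def inverseAlpha (f : ℝ × ℝ → ℂ) (hf : Integrable f) : L2 →L[ℂ] L2 :=
  LinearMap.mkContinuous
    { toFun := fun s => ∫ z : ℝ × ℝ, f z • modulation (-z.2) (translation (-z.1) s)
      map_add' := fun s t => by
        simp only [map_add, smul_add]
        exact integral_add (integrable_smul_modulation_translation hf s)
          (integrable_smul_modulation_translation hf t)
      map_smul' := fun c s => by
        simp only [map_smul, RingHom.id_apply]
        rw [← integral_smul]
        exact integral_congr_ae (Filter.Eventually.of_forall fun z => smul_comm _ _ _) }
    (∫ z, ‖f z‖) fun s => by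
      refine (norm_integral_le_integral_norm _).trans_eq ?_
      simp only [norm_smul, LinearIsometry.norm_map]
      exact integral_mul_const _ _

end AlphaTransform

end

/-!
The matrix coefficients of the unitaries `M_{-y} T_{-x}` are the functions
`ambiguity s t (x, y) = ⟪s, M_{-y} T_{-x} t⟫`, and `Θ(f)` is the operator with
`⟪s, Θ(f) t⟫ = ∬ f · ambiguity s t` (`IsAlphaOp f A`). For fixed `x`, the function
`y ↦ ambiguity s t (x, y)` is a Fourier transform, so Plancherel's theorem and Tonelli's theorem give
Moyal's identity `∬ |ambiguity s t|² = ‖s‖² ‖t‖²` (`lintegral_ambiguity_sq`). Together with the bound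
`|ambiguity s t| ≤ ‖s‖ ‖t‖` it puts `ambiguity s t` into `L^{p'}` with norm at most `‖s‖ ‖t‖`, for
every `p' ∈ [2, ∞]`. By Hölder's inequality the sesquilinear form above is then bounded for
`f ∈ L^p`, which defines `Θ_p(f)` and shows `‖Θ_p(f)‖ ≤ ‖f‖_p`.

By polarization, `ambiguity (e i) (e j)` is an orthonormal family in `L²(ℝ²)` for every orthonormal
basis `e`, so Bessel's inequality gives the Hilbert–Schmidt bound `∑ ‖Θ(f) (e i)‖² ≤ ‖f‖₂²`
(`IsAlphaOp.tsum_norm_sq_le`). Hilbert–Schmidt operators are compact and simple functions are dense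
in `L^p`, hence every `Θ_p(f)` is compact. This settles `p = 1`.

For `p > 1`, compactness provides an orthonormal basis `b` of eigenvectors of `|A|`, where
`A = Θ_p(f)`, and `tr |A|^q = ∑ ‖A (b i)‖^q` (`exists_schattenNorm_eq_tsum`). For a fixed basis the
map `f ↦ (‖Θ(f) (b i)‖)_i` is sublinear and bounded from `L¹` to `ℓ^∞` and from `L²` to `ℓ²`, with
constants independent of the basis. The argument of Marcinkiewicz's interpolation theorem
(`tsum_rpow_le_of_truncation`, `IsAlphaOp.tsum_norm_rpow_le`) therefore bounds it from `L^p` to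
`ℓ^{p'}`. In place of complex interpolation this yields some constant `C`, which is all that is
asserted.
-/

noncomputable section

namespace AlphaTransform

/-! ### Compact operators, eigenbases and Schatten norms -/

section Operators

universe u v

variable {E : Type u} [NormedAddCommGroup E] [InnerProductSpace ℂ E] [CompleteSpace E]

/-- The continuous functional calculus acts on an eigenvector through the value of the function at
the eigenvalue. This holds for polynomials, hence for all continuous functions by density. -/
theorem cfc_apply_eigenvector {T : E →L[ℂ] E} (hT : IsSelfAdjoint T) {v : E} {μ : ℝ}
    (hv : T v = (μ : ℂ) • v) (f : ℝ → ℝ) (hf : ContinuousOn f (spectrum ℝ T)) :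
    cfc f T v = (f μ : ℂ) • v := by
  by_cases hv0 : v = 0
  · simp [hv0]
  have hμ : μ ∈ spectrum ℝ T := by
    rw [spectrum.mem_iff]
    intro h
    obtain ⟨u, hu⟩ := h
    apply hv0
    have h1 : (u : E →L[ℂ] E) v = 0 := by
      rw [hu, sub_apply, hv, Algebra.algebraMap_eq_smul_one]
      simp
    have h2 : ((u⁻¹ : (E →L[ℂ] E)ˣ) * u : E →L[ℂ] E) v = 0 := by
      rw [mul_apply_eq_comp, h1, map_zero]
    simpa using h2
  have key : ∀ g : C(spectrum ℝ T, ℝ),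
      cfcHom (R := ℝ) hT g v = ((g ⟨μ, hμ⟩ : ℝ) : ℂ) • v := by
    intro g
    induction g using ContinuousMap.induction_on_of_compact with
    | const r =>
      have : ContinuousMap.const (spectrum ℝ T) r = algebraMap ℝ C(spectrum ℝ T, ℝ) r := rfl
      rw [this, AlgHomClass.commutes, Algebra.algebraMap_eq_smul_one]
      simp
    | id => rw [cfcHom_id hT, hv]; rfl
    | star_id => rw [map_star, cfcHom_id hT, hT.star_eq, hv]; rfl
    | add f g hf hg => simp [hf, hg, add_smul]
    | mul f g hf hg =>
      rw [map_mul, mul_apply_eq_comp, hg, map_smul, hf, smul_smul, mul_comm,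
        ContinuousMap.mul_apply, Complex.ofReal_mul]
    | frequently g hg =>
      have hcl : IsClosed {g : C(spectrum ℝ T, ℝ) |
          cfcHom (R := ℝ) hT g v = ((g ⟨μ, hμ⟩ : ℝ) : ℂ) • v} := by
        refine isClosed_eq ?_ ?_
        · exact (ContinuousLinearMap.apply ℂ E v).continuous.comp (cfcHom_continuous hT)
        · have : Continuous fun g : C(spectrum ℝ T, ℝ) => g ⟨μ, hμ⟩ :=
            continuous_eval_const _
          fun_prop
      exact hcl.mem_of_frequently_of_tendsto hg Filter.tendsto_id
  rw [cfc_apply f T hT hf, key]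
  rfl

/-- Closed orthogonal subspaces with dense sum have orthonormal bases whose union is an orthonormal
basis of the whole space. -/
theorem exists_hilbertBasis_mem_orthogonalFamily {κ : Type v} {W : κ → Submodule ℂ E}
    [∀ k, CompleteSpace (W k)] (hW : OrthogonalFamily ℂ (fun k => W k) fun k => (W k).subtypeₗᵢ)
    (hsup : (⨆ k, W k)ᗮ = ⊥) :
    ∃ (ι : Type (max v u)) (b : HilbertBasis ι ℂ E), ∀ i, ∃ k, b i ∈ W k := by
  choose w c hw using fun k => exists_hilbertBasis ℂ (W k)
  let v : (Σ k, w k) → E := fun a => (c a.1 a.2 : E)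
  have hon : Orthonormal ℂ v :=
    hW.orthonormal_sigma_orthonormal (v_family := fun k => c k) fun k => (c k).orthonormal
  have hsp : (Submodule.span ℂ (Set.range v))ᗮ = ⊥ := by
    refine le_bot_iff.1 (hsup ▸ ?_)
    rw [← Submodule.iInf_orthogonal]
    refine le_iInf fun k x hx => ?_
    rw [Submodule.mem_orthogonal]
    intro u hu
    let P : W k →L[ℂ] ℂ := (innerSL ℂ x).comp (W k).subtypeL
    have hP : P = 0 := by
      refine ContinuousLinearMap.ext_on (s := Set.range (c k))
        (Submodule.dense_iff_topologicalClosure_eq_top.2 (c k).dense_span) ?_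
      rintro _ ⟨i, rfl⟩
      have h1 : ⟪(c k i : E), x⟫_ℂ = 0 :=
        (Submodule.mem_orthogonal _ _).1 hx _ (Submodule.subset_span ⟨⟨k, i⟩, rfl⟩)
      exact inner_eq_zero_symm.1 h1
    have h2 : ⟪x, u⟫_ℂ = 0 := congrArg (fun F : W k →L[ℂ] ℂ => F ⟨u, hu⟩) hP
    exact inner_eq_zero_symm.1 h2
  refine ⟨_, HilbertBasis.mkOfOrthogonalEqBot hon hsp, fun a => ⟨a.1, ?_⟩⟩
  rw [HilbertBasis.coe_mkOfOrthogonalEqBot]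
  exact (c a.1 a.2).2

/-- The spectral theorem for a compact self-adjoint operator, as an orthonormal basis of
eigenvectors with real eigenvalues. -/
theorem exists_hilbertBasis_eigenvectors {T : E →L[ℂ] E} (hc : IsCompactOperator T)
    (hT : IsSelfAdjoint T) :
    ∃ (ι : Type u) (b : HilbertBasis ι ℂ E) (μ : ι → ℝ), ∀ i, T (b i) = (μ i : ℂ) • b i := by
  have hs : (T : E →ₗ[ℂ] E).IsSymmetric := hT.isSymmetric
  have : ∀ μ : ℂ, CompleteSpace (Module.End.eigenspace (T : E →ₗ[ℂ] E) μ) := by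
    intro μ
    have h1 : (Module.End.eigenspace (T : E →ₗ[ℂ] E) μ : Set E) = {v | T v = μ • v} := by
      ext v
      exact Module.End.mem_eigenspace_iff
    have h2 : IsClosed (Module.End.eigenspace (T : E →ₗ[ℂ] E) μ : Set E) := by
      rw [h1]
      exact isClosed_eq T.continuous (continuous_const_smul μ)
    exact h2.completeSpace_coe
  obtain ⟨ι, b, hb⟩ := exists_hilbertBasis_mem_orthogonalFamily hs.orthogonalFamily_eigenspaces
    (T.orthogonalComplement_iSup_eigenspaces_eq_bot hc hs)
  choose μ hμ using hb
  refine ⟨ι, b, fun i => (μ i).re, fun i => ?_⟩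
  have h2 : conj (μ i) = μ i := hs.conj_eigenvalue_eq_self
    (Module.End.hasEigenvalue_of_hasEigenvector ⟨hμ i, b.orthonormal.ne_zero i⟩)
  rw [Complex.conj_eq_iff_re.1 h2]
  exact Module.End.mem_eigenspace_iff.1 (hμ i)

/-- The basis consists of eigenvectors of `A* A`; the eigenvalue of `b i` is `‖A (b i)‖ ^ 2`. -/
theorem exists_schattenNorm_eq_tsum {A : E →L[ℂ] E} (hA : IsCompactOperator A) {q : ℝ≥0∞}
    (hq : q ≠ ∞) :
    ∃ (ι : Type u) (b : HilbertBasis ι ℂ E),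
      schattenNorm q A = (∑' i, ENNReal.ofReal (‖A (b i)‖ ^ q.toReal)) ^ (1 / q.toReal) := by
  have hsa : IsSelfAdjoint (star A * A) := IsSelfAdjoint.star_mul_self A
  have hc : IsCompactOperator (star A * A : E →L[ℂ] E) := hA.clm_comp (star A)
  obtain ⟨ι, b, μ, hb⟩ := exists_hilbertBasis_eigenvectors hc hsa
  have hr : (0 : ℝ) ≤ q.toReal := ENNReal.toReal_nonneg
  have hpos : 0 ≤ star A * A := star_mul_self_nonneg A
  have hμ : ∀ i, μ i = ‖A (b i)‖ ^ 2 := by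
    intro i
    have h1 : ⟪b i, (star A * A) (b i)⟫_ℂ = ((‖A (b i)‖ ^ 2 : ℝ) : ℂ) := by
      rw [ContinuousLinearMap.star_eq_adjoint, mul_apply_eq_comp,
        ContinuousLinearMap.adjoint_inner_right, inner_self_eq_norm_sq_to_K (𝕜 := ℂ)]
      norm_cast
    rw [hb, inner_smul_right, inner_self_eq_norm_sq_to_K (𝕜 := ℂ), b.orthonormal.norm_eq_one] at h1
    have h2 := congrArg Complex.re h1
    rw [Complex.ofReal_re] at h2
    simpa using h2
  have habs : CFC.abs A ^ q.toReal = (star A * A) ^ (q.toReal / 2) := by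
    rw [CFC.abs, CFC.sqrt_eq_rpow, CFC.rpow_rpow_of_exponent_nonneg _ _ _ (by norm_num) hr]
    congr 1
    ring
  refine ⟨ι, b, ?_⟩
  rw [schattenNorm, if_neg hq, posTrace_eq ((ContinuousLinearMap.nonneg_iff_isPositive _).1
    CFC.rpow_nonneg) b]
  congr 1
  refine tsum_congr fun i => ?_
  rw [habs, CFC.rpow_eq_cfc_real, cfc_apply_eigenvector hsa (hb i) _
    (Real.continuous_rpow_const (by positivity)).continuousOn, inner_smul_right,
    inner_self_eq_norm_sq_to_K (𝕜 := ℂ), b.orthonormal.norm_eq_one, hμ,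
    ← Real.rpow_natCast, ← Real.rpow_mul (norm_nonneg _)]
  simp [mul_div_cancel₀]

/-- A Hilbert–Schmidt operator is compact, being the norm limit of its restrictions to the spans of
finitely many basis vectors. -/
theorem isCompactOperator_of_tsum_ne_top {ι : Type*} (b : HilbertBasis ι ℂ E) {A : E →L[ℂ] E}
    (hA : ∑' i, ENNReal.ofReal (‖A (b i)‖ ^ 2) ≠ ∞) : IsCompactOperator A := by
  have hs : Summable fun i => ‖A (b i)‖ ^ 2 := by
    have := ENNReal.summable_toReal hA
    simpa [ENNReal.toReal_ofReal] using this
  let P : Finset ι → E →L[ℂ] E := fun F =>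
    ∑ i ∈ F, (ContinuousLinearMap.toSpanSingleton ℂ (A (b i))).comp (innerSL ℂ (b i))
  have hP : ∀ F, IsCompactOperator (P F) := by
    intro F
    have h1 : P F ∈ compactOperator (RingHom.id ℂ) E E := by
      refine Submodule.sum_mem _ fun i _ => ?_
      have h1 : IsCompactOperator (ContinuousLinearMap.toSpanSingleton ℂ (A (b i))) :=
        isCompactOperator_of_locallyCompactSpace_rng _
      exact h1.comp_clm (innerSL ℂ (b i))
    exact h1
  have hb : ∀ F, ‖A - P F‖ ≤ Real.sqrt (∑' i : {i // i ∉ F}, ‖A (b i)‖ ^ 2) := by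
    intro F
    refine ContinuousLinearMap.opNorm_le_bound _ (Real.sqrt_nonneg _) fun v => ?_
    have h1 : HasSum (fun i => ⟪b i, v⟫_ℂ • A (b i)) (A v) := by
      simpa [HilbertBasis.repr_apply_apply] using A.hasSum (b.hasSum_repr v)
    have h2 : HasSum (fun i : {i // i ∉ F} => ⟪b i, v⟫_ℂ • A (b i)) ((A - P F) v) := by
      refine (Finset.hasSum_compl_iff (f := fun i => ⟪b i, v⟫_ℂ • A (b i)) F).2 ?_
      convert h1
      simp [P]
    have h3 : Summable fun i => ‖⟪b i, v⟫_ℂ‖ ^ 2 := b.orthonormal.inner_products_summable v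
    have h4 : ∑' i : {i // i ∉ F}, ‖⟪b i, v⟫_ℂ‖ ^ 2 ≤ ‖v‖ ^ 2 :=
      (h3.tsum_subtype_le (fun i => ‖⟪b i, v⟫_ℂ‖ ^ 2) {i | i ∉ F} (fun i => by positivity)).trans
        (b.orthonormal.tsum_inner_products_le v)
    have hinj : Function.Injective fun i : {i // i ∉ F} => (i : ι) := Subtype.val_injective
    obtain ⟨h5, h6⟩ := Real.summable_and_inner_le_Lp_mul_Lq_tsum_of_nonneg
      (f := fun i : {i // i ∉ F} => ‖⟪b i, v⟫_ℂ‖) (g := fun i : {i // i ∉ F} => ‖A (b i)‖)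
      Real.HolderConjugate.two_two (fun i => norm_nonneg _) (fun i => norm_nonneg _)
      (by simpa [Function.comp_def] using h3.comp_injective hinj)
      (by simpa [Function.comp_def] using hs.comp_injective hinj)
    simp only [Real.rpow_two, ← Real.sqrt_eq_rpow] at h6
    rw [← h2.tsum_eq]
    have h7 : Summable fun i : {i // i ∉ F} => ‖⟪b i, v⟫_ℂ • A (b i)‖ := by
      simpa only [norm_smul] using h5
    refine (norm_tsum_le_tsum_norm h7).trans ?_
    simp only [norm_smul]
    refine h6.trans ?_
    rw [mul_comm]
    gcongr
    exact Real.sqrt_le_iff.2 ⟨norm_nonneg _, h4⟩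
  refine isCompactOperator_of_tendsto (l := Filter.atTop) (F := P) ?_
    (Filter.Eventually.of_forall hP)
  rw [tendsto_iff_norm_sub_tendsto_zero]
  have := (tendsto_tsum_compl_atTop_zero fun i => ‖A (b i)‖ ^ 2).sqrt
  rw [Real.sqrt_zero] at this
  refine squeeze_zero (fun _ => norm_nonneg _) (fun F => ?_) this
  rw [norm_sub_rev]
  exact hb F

end Operators

/-! ### Plancherel's theorem on `L¹ ∩ L²` -/

section Plancherel
open scoped FourierTransform SchwartzMap

theorem eLpNorm_two_sq {α F : Type*} [MeasurableSpace α] [NormedAddCommGroup F] (μ : Measure α)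
    (f : α → F) : eLpNorm f 2 μ ^ 2 = ∫⁻ x, ‖f x‖ₑ ^ 2 ∂μ := by
  have := eLpNorm_nnreal_pow_eq_lintegral (f := f) (μ := μ) (p := 2) (by norm_num)
  simpa using this

/-- Plancherel's theorem for the Fourier integral of a function in `L¹ ∩ L²`. The Fourier integral
agrees almost everywhere with the Fourier transform on `L²`, as both have the same integral against
every test function. -/
theorem eLpNorm_fourier {g : ℝ → ℂ} (h1 : Integrable g) (h2 : MemLp g 2) :
    eLpNorm (𝓕 g) 2 = eLpNorm g 2 := by
  have hcont : Continuous (𝓕 g) := VectorFourier.fourierIntegral_continuous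
    Real.continuous_fourierChar (innerSL ℝ).continuous₂ h1
  have key : (𝓕 (h2.toLp g) : Lp ℂ 2 (volume : Measure ℝ)) =ᵐ[volume] 𝓕 g := by
    refine ae_eq_of_integral_contDiff_smul_eq ((Lp.memLp _).locallyIntegrable (by norm_num))
      hcont.locallyIntegrable fun φ hφ hφc => ?_
    have hc : HasCompactSupport (Complex.ofRealCLM ∘ φ) := hφc.comp_left rfl
    have hs : ContDiff ℝ (⊤ : ℕ∞) (Complex.ofRealCLM ∘ φ) := Complex.ofRealCLM.contDiff.comp hφ
    let Φ : 𝓢(ℝ, ℂ) := hc.toSchwartzMap hs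
    calc ∫ x, φ x • (𝓕 (h2.toLp g) : Lp ℂ 2 (volume : Measure ℝ)) x
        = ∫ x, Φ x • (𝓕 (h2.toLp g) : Lp ℂ 2 (volume : Measure ℝ)) x := by simp [Φ]
      _ = Lp.toTemperedDistribution (𝓕 (h2.toLp g) : Lp ℂ 2 (volume : Measure ℝ)) Φ :=
          (Lp.toTemperedDistribution_apply _ _).symm
      _ = Lp.toTemperedDistribution (h2.toLp g) (𝓕 Φ) := by
          rw [← Lp.fourier_toTemperedDistribution_eq]
          rfl
      _ = ∫ x, 𝓕 Φ x • h2.toLp g x := Lp.toTemperedDistribution_apply _ _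
      _ = ∫ x, 𝓕 (Φ : ℝ → ℂ) x • g x := by
          refine integral_congr_ae ?_
          filter_upwards [h2.coeFn_toLp] with x hx
          rw [hx, SchwartzMap.fourier_coe]
      _ = ∫ x, Φ x • 𝓕 g x := by
          have := VectorFourier.integral_bilin_fourierIntegral_eq_flip
            (ContinuousLinearMap.lsmul ℂ ℂ) (L := innerₗ ℝ)
            Real.continuous_fourierChar continuous_inner Φ.integrable h1 (μ := volume)
            (ν := volume)
          simpa using! this
      _ = ∫ x, φ x • 𝓕 g x := by simp [Φ]
  rw [← eLpNorm_congr_ae key, ← eLpNorm_congr_ae h2.coeFn_toLp]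
  have h3 := Lp.norm_fourier_eq (h2.toLp g)
  rw [Lp.norm_def, Lp.norm_def] at h3
  exact (ENNReal.toReal_eq_toReal_iff' (Lp.eLpNorm_ne_top _) (Lp.eLpNorm_ne_top _)).1 h3

end Plancherel

/-! ### Ambiguity functions and Moyal's identity -/

section Ambiguity
open scoped FourierTransform

/-- The matrix coefficient `(x, y) ↦ ⟪s, M_{-y} T_{-x} t⟫`, the (cross-)ambiguity function of `s` and
`t`. It is conjugate-linear in `s` and linear in `t`. -/
def ambiguity (s t : L2) (z : ℝ × ℝ) : ℂ :=
  ⟪s, modulation (-z.2) (translation (-z.1) t)⟫_ℂ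

theorem continuous_ambiguity (s t : L2) : Continuous (ambiguity s t) :=
  continuous_const.inner (continuous_modulation_translation t)

theorem norm_ambiguity_le (s t : L2) (z : ℝ × ℝ) : ‖ambiguity s t z‖ ≤ ‖s‖ * ‖t‖ := by
  refine (norm_inner_le_norm _ _).trans_eq ?_
  rw [LinearIsometry.norm_map, LinearIsometry.norm_map]

theorem ambiguity_eq_fourier (s t : L2) (x y : ℝ) :
    ambiguity s t (x, y) = 𝓕 (fun u => conj (s u) * t (u + x)) (-y) := by
  rw [ambiguity, L2.inner_def, Real.fourier_real_eq_integral_exp_smul]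
  refine integral_congr_ae ?_
  filter_upwards [coeFn_modulation (-y) (translation (-x) t), coeFn_translation (-x) t]
    with u h1 h2
  rw [h1, h2, RCLike.inner_apply, sub_neg_eq_add, char, smul_eq_mul]
  have : (-2 * Real.pi * Complex.I * ((-y : ℝ) : ℂ) * u : ℂ)
      = ((-2 * Real.pi * u * -y : ℝ) : ℂ) * Complex.I := by
    push_cast
    ring
  rw [this]
  ring

theorem lintegral_enorm_sq (s : L2) : ∫⁻ u, ‖s u‖ₑ ^ 2 = ‖s‖ₑ ^ 2 := by
  rw [← eLpNorm_two_sq, Lp.enorm_def]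

theorem integrable_conj_mul_comp_add (s t : L2) (x : ℝ) :
    Integrable fun u => conj (s u) * t (u + x) := by
  have h := L2.integrable_inner (𝕜 := ℂ) s (translation (-x) t)
  refine h.congr ?_
  filter_upwards [coeFn_translation (-x) t] with u h2
  rw [h2, RCLike.inner_apply, sub_neg_eq_add, mul_comm]

/-- Moyal's identity. -/
theorem lintegral_ambiguity_sq (s t : L2) :
    ∫⁻ z, ‖ambiguity s t z‖ₑ ^ 2 = ‖s‖ₑ ^ 2 * ‖t‖ₑ ^ 2 := by
  have hs : Measurable fun u => s u := (Lp.stronglyMeasurable s).measurable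
  have ht : Measurable fun u => t u := (Lp.stronglyMeasurable t).measurable
  have hm : Measurable fun z : ℝ × ℝ => ‖conj (s z.2) * t (z.2 + z.1)‖ₑ ^ 2 := by
    have hs' : Measurable fun u => conj (s u) := Complex.continuous_conj.measurable.comp hs
    exact ((hs'.comp measurable_snd).mul
      (ht.comp (measurable_snd.add measurable_fst))).enorm.pow_const 2
  have htot : ∫⁻ x, ∫⁻ u, ‖conj (s u) * t (u + x)‖ₑ ^ 2 = ‖s‖ₑ ^ 2 * ‖t‖ₑ ^ 2 := by
    rw [lintegral_lintegral_swap hm.aemeasurable]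
    have h1 : ∀ u, ∫⁻ x, ‖conj (s u) * t (u + x)‖ₑ ^ 2 = ‖s u‖ₑ ^ 2 * ‖t‖ₑ ^ 2 := by
      intro u
      simp only [enorm_mul, mul_pow, RCLike.enorm_conj]
      rw [lintegral_const_mul _ (by fun_prop),
        lintegral_add_left_eq_self (fun x => ‖t x‖ₑ ^ 2) u, lintegral_enorm_sq]
    simp only [h1]
    rw [lintegral_mul_const _ (by fun_prop), lintegral_enorm_sq]
  -- Plancherel's theorem applies only to those `x` for which the slice lies in `L²`.
  have hfin : ∀ᵐ x, ∫⁻ u, ‖conj (s u) * t (u + x)‖ₑ ^ 2 < ∞ := by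
    refine ae_lt_top hm.lintegral_prod_right' ?_
    rw [htot]
    finiteness
  rw [Measure.volume_eq_prod, lintegral_prod _
    ((continuous_ambiguity s t).measurable.enorm.pow_const 2).aemeasurable, ← htot]
  refine lintegral_congr_ae ?_
  filter_upwards [hfin] with x hx
  have h1 := integrable_conj_mul_comp_add s t x
  have h2 : MemLp (fun u => conj (s u) * t (u + x)) 2 := by
    refine ⟨h1.aestronglyMeasurable, ?_⟩
    rw [← eLpNorm_two_sq] at hx
    exact (ENNReal.pow_lt_top_iff.1 hx).resolve_right (by norm_num)
  simp only [ambiguity_eq_fourier]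
  rw [lintegral_neg_eq_self
    (f := fun y => ‖𝓕 (fun u => conj (s u) * t (u + x)) y‖ₑ ^ 2), ← eLpNorm_two_sq,
    ← eLpNorm_two_sq, eLpNorm_fourier h1 h2]

theorem ambiguity_add_left (s s' t : L2) : ambiguity (s + s') t = ambiguity s t + ambiguity s' t :=
  funext fun _ => inner_add_left _ _ _

theorem ambiguity_add_right (s t t' : L2) :
    ambiguity s (t + t') = ambiguity s t + ambiguity s t' :=
  funext fun _ => by simp [ambiguity, inner_add_right]

theorem ambiguity_smul_left (c : ℂ) (s t : L2) : ambiguity (c • s) t = conj c • ambiguity s t :=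
  funext fun _ => inner_smul_left _ _ _

theorem ambiguity_smul_right (c : ℂ) (s t : L2) : ambiguity s (c • t) = c • ambiguity s t :=
  funext fun _ => by simp [ambiguity, inner_smul_right]

theorem memLp_ambiguity_two (s t : L2) : MemLp (ambiguity s t) 2 := by
  refine ⟨(continuous_ambiguity s t).aestronglyMeasurable, ?_⟩
  have h : eLpNorm (ambiguity s t) 2 volume ^ 2 < ∞ := by
    rw [eLpNorm_two_sq, lintegral_ambiguity_sq]
    finiteness
  exact (ENNReal.pow_lt_top_iff.1 h).resolve_right (by norm_num)

/-- The complex conjugate of the ambiguity function as an element of `L²(ℝ²)`. Conjugation turns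
`∬ f · ambiguity s t` into the inner product of `ambiguityConjL2 s t` with `f`. -/
def ambiguityConjL2 : L2 →ₗ[ℂ] L2 →ₗ⋆[ℂ] Lp ℂ 2 (volume : Measure (ℝ × ℝ)) :=
  LinearMap.mk₂'ₛₗ (RingHom.id ℂ) (starRingEnd ℂ)
    (fun s t => (memLp_ambiguity_two s t).star.toLp)
    (fun s s' t => by
      rw [← MemLp.toLp_add]; congr 1; rw [ambiguity_add_left, star_add])
    (fun c s t => by
      rw [← MemLp.toLp_const_smul]; congr 1; rw [ambiguity_smul_left, star_smul]; simp)
    (fun s t t' => by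
      rw [← MemLp.toLp_add]; congr 1; rw [ambiguity_add_right, star_add])
    (fun c s t => by
      rw [← MemLp.toLp_const_smul]; congr 1; rw [ambiguity_smul_right, star_smul]; rfl)

theorem coeFn_ambiguityConjL2 (s t : L2) :
    ambiguityConjL2 s t =ᵐ[volume] fun z => conj (ambiguity s t z) :=
  (memLp_ambiguity_two s t).star.coeFn_toLp

theorem norm_ambiguityConjL2 (s t : L2) : ‖ambiguityConjL2 s t‖ = ‖s‖ * ‖t‖ := by
  have h : ‖ambiguityConjL2 s t‖ₑ ^ 2 = (‖s‖ₑ * ‖t‖ₑ) ^ 2 := by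
    rw [Lp.enorm_def, eLpNorm_two_sq, mul_pow, ← lintegral_ambiguity_sq]
    refine lintegral_congr_ae ?_
    filter_upwards [coeFn_ambiguityConjL2 s t] with z hz
    rw [hz, RCLike.enorm_conj]
  have h2 := (ENNReal.pow_right_strictMono (n := 2) (by norm_num)).injective h
  simpa using congrArg ENNReal.toReal h2

end Ambiguity

/-! ### Orthonormal families from sesquilinear maps -/

section Bilinear

variable {E H : Type*} [NormedAddCommGroup E] [InnerProductSpace ℂ E] [NormedAddCommGroup H]
  [InnerProductSpace ℂ H]

/-- A map that scales all norms by the same factor preserves orthogonality. The condition on `I`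
covers linear maps (`d = I`) and conjugate-linear maps (`d = -I`). -/
theorem inner_map_eq_zero_of_norm_map_eq {c : ℝ} {f : E → H} (hadd : ∀ s t, f (s + t) = f s + f t)
    (hI : ∃ d : ℂ, d.im ≠ 0 ∧ ∀ t, f (Complex.I • t) = d • f t)
    (hnorm : ∀ t, ‖f t‖ = c * ‖t‖) {s t : E} (hst : ⟪s, t⟫_ℂ = 0) : ⟪f s, f t⟫_ℂ = 0 := by
  have hre : ∀ u, ⟪s, u⟫_ℂ = 0 → (⟪f s, f u⟫_ℂ).re = 0 := by
    intro u hu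
    have h1 := norm_add_sq (𝕜 := ℂ) s u
    have h2 := norm_add_sq (𝕜 := ℂ) (f s) (f u)
    rw [← hadd, hnorm, hnorm, hnorm, mul_pow, h1, hu] at h2
    have h3 : RCLike.re ⟪f s, f u⟫_ℂ = (⟪f s, f u⟫_ℂ).re := rfl
    rw [h3, map_zero] at h2
    linarith
  obtain ⟨d, hd, hI⟩ := hI
  have h1 := hre t hst
  have h2 := hre (Complex.I • t) (by rw [inner_smul_right, hst, mul_zero])
  rw [hI, inner_smul_right, Complex.mul_re, h1] at h2
  refine Complex.ext h1 ?_
  simpa [hd] using h2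

/-- A sesquilinear map with `‖B s t‖ = ‖s‖ ‖t‖` sends pairs from an orthonormal family to an
orthonormal family, by polarization in each variable. -/
theorem orthonormal_sesquilinear (B : E →ₗ[ℂ] E →ₗ⋆[ℂ] H) (hB : ∀ s t, ‖B s t‖ = ‖s‖ * ‖t‖)
    {ι : Type*} {e : ι → E} (he : Orthonormal ℂ e) :
    Orthonormal ℂ fun p : ι × ι => B (e p.1) (e p.2) := by
  have hright : ∀ s {t t'}, ⟪t, t'⟫_ℂ = 0 → ⟪B s t, B s t'⟫_ℂ = 0 := fun s t t' h =>
    inner_map_eq_zero_of_norm_map_eq (f := B s) (map_add _)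
      ⟨-Complex.I, by simp, fun t => by simp⟩ (hB s) h
  have hleft : ∀ t {s s'}, ⟪s, s'⟫_ℂ = 0 → ⟪B s t, B s' t⟫_ℂ = 0 := fun t s s' h =>
    inner_map_eq_zero_of_norm_map_eq (f := fun s => B s t) (fun s s' => by simp)
      ⟨Complex.I, by simp, fun t => by simp⟩ (fun s => (hB s t).trans (mul_comm _ _)) h
  refine ⟨fun p => by rw [hB, he.norm_eq_one, he.norm_eq_one, mul_one], ?_⟩
  rintro ⟨i, j⟩ ⟨k, l⟩ hne
  show ⟪B (e i) (e j), B (e k) (e l)⟫_ℂ = 0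
  by_cases hik : i = k
  · subst hik
    exact hright _ (he.inner_eq_zero fun h => hne (by rw [h]))
  by_cases hjl : j = l
  · subst hjl
    exact hleft _ (he.inner_eq_zero hik)
  have hj := he.inner_eq_zero hjl
  -- Orthogonality of `B s (e j)` and `B s (e l)` for `s = e i + c • e k`; the choices `c = 1` and
  -- `c = I` then separate the two cross terms.
  have key : ∀ c : ℂ, c * ⟪B (e i) (e j), B (e k) (e l)⟫_ℂ
      + conj c * ⟪B (e k) (e j), B (e i) (e l)⟫_ℂ = 0 := by
    intro c
    have h := hright (e i + c • e k) hj
    simp only [map_add, map_smul, LinearMap.add_apply, LinearMap.smul_apply, inner_add_left,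
      inner_add_right, inner_smul_left, inner_smul_right, hright (e i) hj, hright (e k) hj] at h
    linear_combination h
  have h1 := key 1
  have h2 := key Complex.I
  rw [Complex.conj_I] at h2
  simp only [map_one, one_mul] at h1
  linear_combination (1 / 2 : ℂ) * h1 - (Complex.I / 2) * h2
    + (⟪B (e i) (e j), B (e k) (e l)⟫_ℂ - ⟪B (e k) (e j), B (e i) (e l)⟫_ℂ) / 2 * Complex.I_mul_I

/-- Bessel's inequality with values in `[0, ∞]`. -/
theorem tsum_inner_sq_le {ι : Type*} {v : ι → H} (hv : Orthonormal ℂ v) (x : H) :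
    ∑' i, ENNReal.ofReal (‖⟪v i, x⟫_ℂ‖ ^ 2) ≤ ENNReal.ofReal (‖x‖ ^ 2) := by
  rw [← ENNReal.ofReal_tsum_of_nonneg (fun _ => by positivity) (hv.inner_products_summable x)]
  exact ENNReal.ofReal_le_ofReal (hv.tsum_inner_products_le x)

end Bilinear

/-! ### The operators `Θ_p(f)` -/

section AlphaOperators

theorem two_le_of_inv_add_inv {p q : ℝ≥0∞} (hp2 : p ≤ 2) (hpq : p⁻¹ + q⁻¹ = 1) : 2 ≤ q := by
  rw [← ENNReal.inv_le_inv]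
  have h1 : (2 : ℝ≥0∞)⁻¹ ≤ p⁻¹ := ENNReal.inv_le_inv.2 hp2
  have h2 : (2 : ℝ≥0∞)⁻¹ + q⁻¹ ≤ 2⁻¹ + 2⁻¹ := by
    rw [ENNReal.inv_two_add_inv_two, ← hpq]
    gcongr
  exact (ENNReal.add_le_add_iff_left (by norm_num)).1 h2

/-- The case `q = 2` is Moyal's identity, the case `q = ∞` the Cauchy–Schwarz inequality; in between,
`|v| ^ q ≤ ‖v‖_∞ ^ (q - 2) |v| ^ 2`. -/
theorem eLpNorm_ambiguity_le {q : ℝ≥0∞} (hq : 2 ≤ q) (s t : L2) :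
    eLpNorm (ambiguity s t) q ≤ ‖s‖ₑ * ‖t‖ₑ := by
  have hle : ∀ z, ‖ambiguity s t z‖ₑ ≤ ‖s‖ₑ * ‖t‖ₑ := by
    intro z
    have := norm_ambiguity_le s t z
    rw [← ofReal_norm, ← ofReal_norm, ← ofReal_norm,
      ← ENNReal.ofReal_mul (norm_nonneg _)]
    exact ENNReal.ofReal_le_ofReal this
  rcases eq_or_ne q ∞ with rfl | hqt
  · rw [eLpNorm_exponent_top]
    exact eLpNormEssSup_le_of_ae_enorm_bound (Filter.Eventually.of_forall hle)
  have hq2 : (2 : ℝ) ≤ q.toReal := by simpa using ENNReal.toReal_mono hqt hq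
  have hq0 : 0 < q.toReal := by linarith
  rw [eLpNorm_eq_lintegral_rpow_enorm_toReal (by rintro rfl; simp at hq) hqt,
    one_div, ENNReal.rpow_inv_le_iff hq0]
  calc ∫⁻ z, ‖ambiguity s t z‖ₑ ^ q.toReal
      ≤ ∫⁻ z, (‖s‖ₑ * ‖t‖ₑ) ^ (q.toReal - 2) * ‖ambiguity s t z‖ₑ ^ 2 := by
        refine lintegral_mono fun z => ?_
        have : ‖ambiguity s t z‖ₑ ^ q.toReal
            = ‖ambiguity s t z‖ₑ ^ (q.toReal - 2) * ‖ambiguity s t z‖ₑ ^ 2 := by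
          rw [← ENNReal.rpow_two, ← ENNReal.rpow_add_of_nonneg _ _ (by linarith) (by norm_num)]
          congr 1
          ring
        simp only [this]
        exact mul_le_mul_left (ENNReal.rpow_le_rpow (hle z) (sub_nonneg.2 hq2)) _
    _ = (‖s‖ₑ * ‖t‖ₑ) ^ q.toReal := by
        rw [lintegral_const_mul _
          ((continuous_ambiguity s t).measurable.enorm.pow_const 2), lintegral_ambiguity_sq,
          ← mul_pow, ← ENNReal.rpow_two, ← ENNReal.rpow_add_of_nonneg _ _ (by linarith)
            (by norm_num)]
        congr 1
        ring

theorem memLp_ambiguity {q : ℝ≥0∞} (hq : 2 ≤ q) (s t : L2) : MemLp (ambiguity s t) q :=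
  ⟨(continuous_ambiguity s t).aestronglyMeasurable,
    (eLpNorm_ambiguity_le hq s t).trans_lt (by finiteness)⟩

theorem integrable_mul_ambiguity {p : ℝ≥0∞} (hp1 : 1 ≤ p) (hp2 : p ≤ 2) {f : ℝ × ℝ → ℂ}
    (hf : MemLp f p) (s t : L2) : Integrable fun z => f z * ambiguity s t z := by
  have hpq : p⁻¹ + (1 - p⁻¹)⁻¹⁻¹ = 1 := by
    rw [inv_inv]
    exact add_tsub_cancel_of_le (ENNReal.inv_le_one.2 hp1)
  have : ENNReal.HolderConjugate p (1 - p⁻¹)⁻¹ := ENNReal.holderConjugate_iff.2 hpq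
  exact hf.integrable_mul (memLp_ambiguity (two_le_of_inv_add_inv hp2 hpq) s t)

theorem norm_integral_mul_ambiguity_le {p : ℝ≥0∞} (hp1 : 1 ≤ p) (hp2 : p ≤ 2) {f : ℝ × ℝ → ℂ}
    (hf : MemLp f p) (s t : L2) :
    ‖∫ z, f z * ambiguity s t z‖ ≤ (eLpNorm f p).toReal * (‖s‖ * ‖t‖) := by
  have hpq : p⁻¹ + (1 - p⁻¹)⁻¹⁻¹ = 1 := by
    rw [inv_inv]
    exact add_tsub_cancel_of_le (ENNReal.inv_le_one.2 hp1)
  have : ENNReal.HolderConjugate p (1 - p⁻¹)⁻¹ := ENNReal.holderConjugate_iff.2 hpq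
  have h : ‖∫ z, f z * ambiguity s t z‖ₑ ≤ eLpNorm f p * (‖s‖ₑ * ‖t‖ₑ) := by
    refine (enorm_integral_le_lintegral_enorm _).trans ?_
    rw [← eLpNorm_one_eq_lintegral_enorm]
    refine (eLpNorm_smul_le_mul_eLpNorm (p := p) (q := (1 - p⁻¹)⁻¹) (r := 1)
      (continuous_ambiguity s t).aestronglyMeasurable hf.1).trans ?_
    gcongr
    exact eLpNorm_ambiguity_le (two_le_of_inv_add_inv hp2 hpq) s t
  have h2 := ENNReal.toReal_mono (by finiteness [hf.2.ne]) h
  simpa using h2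

/-- `A` is the inverse Alpha transform of `f` in the weak sense: its matrix coefficients are the
integrals of `f` against the ambiguity functions. These integrals converge absolutely for
`f ∈ L^p(ℝ²)` with `1 ≤ p ≤ 2`, and the definition is used only for sums of such functions. -/
def IsAlphaOp (f : ℝ × ℝ → ℂ) (A : L2 →L[ℂ] L2) : Prop :=
  ∀ s t, ⟪s, A t⟫_ℂ = ∫ z, f z * ambiguity s t z

theorem IsAlphaOp.unique {f g : ℝ × ℝ → ℂ} {A B : L2 →L[ℂ] L2} (hA : IsAlphaOp f A)
    (hB : IsAlphaOp g B) (hfg : f =ᵐ[volume] g) : A = B := by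
  ext1 t
  refine ext_inner_left ℂ fun s => ?_
  rw [hA, hB]
  refine integral_congr_ae ?_
  filter_upwards [hfg] with z hz
  rw [hz]

theorem IsAlphaOp.congr {f g : ℝ × ℝ → ℂ} {A : L2 →L[ℂ] L2} (hA : IsAlphaOp f A)
    (hfg : f =ᵐ[volume] g) : IsAlphaOp g A := by
  intro s t
  rw [hA]
  refine integral_congr_ae ?_
  filter_upwards [hfg] with z hz
  rw [hz]

theorem IsAlphaOp.add {p r : ℝ≥0∞} (hp1 : 1 ≤ p) (hp2 : p ≤ 2) (hr1 : 1 ≤ r) (hr2 : r ≤ 2)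
    {f g : ℝ × ℝ → ℂ} (hf : MemLp f p) (hg : MemLp g r) {A B : L2 →L[ℂ] L2} (hA : IsAlphaOp f A)
    (hB : IsAlphaOp g B) : IsAlphaOp (f + g) (A + B) := by
  intro s t
  rw [add_apply, inner_add_right, hA, hB,
    ← integral_add (integrable_mul_ambiguity hp1 hp2 hf s t)
      (integrable_mul_ambiguity hr1 hr2 hg s t)]
  simp [add_mul]

theorem IsAlphaOp.smul {f : ℝ × ℝ → ℂ} {A : L2 →L[ℂ] L2} (hA : IsAlphaOp f A) (c : ℂ) :
    IsAlphaOp (c • f) (c • A) := by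
  intro s t
  rw [smul_apply, inner_smul_right, hA, ← integral_const_mul]
  simp [mul_assoc]

theorem IsAlphaOp.sub {p r : ℝ≥0∞} (hp1 : 1 ≤ p) (hp2 : p ≤ 2) (hr1 : 1 ≤ r) (hr2 : r ≤ 2)
    {f g : ℝ × ℝ → ℂ} (hf : MemLp f p) (hg : MemLp g r) {A B : L2 →L[ℂ] L2} (hA : IsAlphaOp f A)
    (hB : IsAlphaOp g B) : IsAlphaOp (f - g) (A - B) := by
  intro s t
  rw [sub_apply, inner_sub_right, hA, hB,
    ← integral_sub (integrable_mul_ambiguity hp1 hp2 hf s t)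
      (integrable_mul_ambiguity hr1 hr2 hg s t)]
  simp [sub_mul]

theorem isAlphaOp_inverseAlpha {f : ℝ × ℝ → ℂ} (hf : Integrable f) :
    IsAlphaOp f (inverseAlpha f hf) := by
  intro s t
  show ⟪s, ∫ z : ℝ × ℝ, f z • modulation (-z.2) (translation (-z.1) t)⟫_ℂ = _
  rw [← integral_inner (integrable_smul_modulation_translation hf t)]
  simp [inner_smul_right, ambiguity]

theorem exists_isAlphaOp {p : ℝ≥0∞} (hp1 : 1 ≤ p) (hp2 : p ≤ 2) {f : ℝ × ℝ → ℂ} (hf : MemLp f p) :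
    ∃ A, IsAlphaOp f A := by
  have hint := integrable_mul_ambiguity hp1 hp2 hf
  let B : L2 →ₗ⋆[ℂ] L2 →ₗ[ℂ] ℂ := LinearMap.mk₂'ₛₗ (starRingEnd ℂ) (RingHom.id ℂ)
    (fun s t => ∫ z, f z * ambiguity s t z)
    (fun s s' t => by
      rw [← integral_add (hint s t) (hint s' t)]
      simp [ambiguity_add_left, mul_add])
    (fun c s t => by
      rw [smul_eq_mul, ← integral_const_mul]
      simp [ambiguity_smul_left, mul_left_comm])
    (fun s t t' => by
      rw [← integral_add (hint s t) (hint s t')]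
      simp [ambiguity_add_right, mul_add])
    (fun c s t => by
      rw [smul_eq_mul, ← integral_const_mul]
      simp [ambiguity_smul_right, mul_left_comm])
  let B' : L2 →L⋆[ℂ] L2 →L[ℂ] ℂ := B.mkContinuous₂ (eLpNorm f p).toReal fun s t => by
    rw [mul_assoc]
    exact norm_integral_mul_ambiguity_le hp1 hp2 hf s t
  refine ⟨ContinuousLinearMap.adjoint (InnerProductSpace.continuousLinearMapOfBilin B'),
    fun s t => ?_⟩
  rw [ContinuousLinearMap.adjoint_inner_right, InnerProductSpace.continuousLinearMapOfBilin_apply]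
  rfl

theorem IsAlphaOp.norm_le {p : ℝ≥0∞} (hp1 : 1 ≤ p) (hp2 : p ≤ 2) {f : ℝ × ℝ → ℂ} (hf : MemLp f p)
    {A : L2 →L[ℂ] L2} (hA : IsAlphaOp f A) : ‖A‖ ≤ (eLpNorm f p).toReal := by
  refine A.opNorm_le_bound ENNReal.toReal_nonneg fun t => ?_
  rcases (norm_nonneg (A t)).eq_or_lt with h0 | h0
  · rw [← h0]
    positivity
  have h1 := norm_integral_mul_ambiguity_le hp1 hp2 hf (A t) t
  rw [← hA, inner_self_eq_norm_sq_to_K (𝕜 := ℂ), norm_pow] at h1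
  simp only [RCLike.norm_ofReal, abs_norm] at h1
  nlinarith

/-- The Hilbert–Schmidt bound, which is Bessel's inequality for the orthonormal family
`ambiguityConjL2 (b i) (b j)`. -/
theorem IsAlphaOp.tsum_norm_sq_le {f : ℝ × ℝ → ℂ} (hf : MemLp f 2) {A : L2 →L[ℂ] L2}
    (hA : IsAlphaOp f A) {ι : Type*} (b : HilbertBasis ι ℂ L2) :
    ∑' i, ENNReal.ofReal (‖A (b i)‖ ^ 2) ≤ eLpNorm f 2 ^ 2 := by
  have h1 := tsum_inner_sq_le
    (orthonormal_sesquilinear ambiguityConjL2 norm_ambiguityConjL2 b.orthonormal) hf.toLp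
  have h2 : ∀ i j, ⟪ambiguityConjL2 (b i) (b j), hf.toLp⟫_ℂ = ⟪b i, A (b j)⟫_ℂ := by
    intro i j
    rw [hA, L2.inner_def]
    refine integral_congr_ae ?_
    filter_upwards [coeFn_ambiguityConjL2 (b i) (b j), hf.coeFn_toLp] with z hz1 hz2
    rw [hz1, hz2, RCLike.inner_apply, Complex.conj_conj]
  simp only [h2] at h1
  rw [ENNReal.tsum_prod (f := fun i j => ENNReal.ofReal (‖⟪b i, A (b j)⟫_ℂ‖ ^ 2)),
    ENNReal.tsum_comm] at h1
  simp only [tsum_inner_sq] at h1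
  refine h1.trans_eq ?_
  rw [Lp.norm_toLp, ← ENNReal.toReal_pow, ENNReal.ofReal_toReal (by finiteness [hf.2.ne])]

/-- Simple functions give Hilbert–Schmidt operators and are dense in `L^p`, while the operator norm is
bounded by the `L^p` norm. -/
theorem IsAlphaOp.isCompactOperator {p : ℝ≥0∞} (hp1 : 1 ≤ p) (hp2 : p ≤ 2) {f : ℝ × ℝ → ℂ}
    (hf : MemLp f p) {A : L2 →L[ℂ] L2} (hA : IsAlphaOp f A) : IsCompactOperator A := by
  have hcl : IsClosed {B : L2 →L[ℂ] L2 | IsCompactOperator B} :=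
    isClosed_setOfPred_isCompactOperator
  have hpt : p ≠ ∞ := ne_top_of_le_ne_top (by norm_num) hp2
  refine hcl.closure_subset (Metric.mem_closure_iff.2 fun ε hε => ?_)
  obtain ⟨g, hg, hgp⟩ := hf.exists_simpleFunc_eLpNorm_sub_lt hpt
    (ε := ENNReal.ofReal ε) (by simpa using hε)
  have hgi : Integrable g volume :=
    (SimpleFunc.memLp_iff_integrable (zero_lt_one.trans_le hp1).ne' hpt).1 hgp
  have hg2 : MemLp g 2 volume :=
    (SimpleFunc.memLp_iff_integrable (by norm_num) (by norm_num)).2 hgi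
  have hB := isAlphaOp_inverseAlpha hgi
  refine ⟨inverseAlpha g hgi, isCompactOperator_of_tsum_ne_top (basis L2)
    (ne_top_of_le_ne_top (by finiteness [hg2.2.ne]) (hB.tsum_norm_sq_le hg2 _)), ?_⟩
  rw [dist_eq_norm]
  refine ((hA.sub hp1 hp2 hp1 hp2 hf hgp hB).norm_le hp1 hp2 (hf.sub hgp)).trans_lt ?_
  exact ENNReal.toReal_lt_of_lt_ofReal hg

end AlphaOperators

/-! ### Marcinkiewicz interpolation -/

section Interpolation

/-- The constant produced by the layer cake argument: the `q`-th power of the bound from `L^p` to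
`ℓ^q`. -/
def interpolationConst (q : ℝ) : ℝ := q * (4 * 2 ^ (q - 2) / (q - 2))

theorem lintegral_Ioc_zero_rpow {r τ : ℝ} (hr : -1 < r) (hτ : 0 ≤ τ) :
    ∫⁻ t in Set.Ioc 0 τ, ENNReal.ofReal (t ^ r) = ENNReal.ofReal (τ ^ (r + 1) / (r + 1)) := by
  have hi : IntegrableOn (fun t : ℝ => t ^ r) (Set.Ioc 0 τ) :=
    (intervalIntegrable_iff_integrableOn_Ioc_of_le hτ).1
      (intervalIntegral.intervalIntegrable_rpow' hr)
  rw [← ofReal_integral_eq_lintegral_ofReal hi, ← intervalIntegral.integral_of_le hτ,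
    integral_rpow (Or.inl hr), Real.zero_rpow (by linarith), sub_zero]
  exact (ae_restrict_iff' measurableSet_Ioc).2
    (Filter.Eventually.of_forall fun t ht => Real.rpow_nonneg ht.1.le _)

/-- The inner integral of the layer cake argument: for `x > 0` the condition on `t` says `t ≤ τ` with
`τ = 2 N ^ p x ^ (1 - p)`, and `x ^ 2 τ ^ (q - 2)` is a multiple of `x ^ p` because
`(p - 1) (q - 2) = 2 - p` for conjugate exponents. -/
theorem sq_mul_lintegral_truncation {p q N x : ℝ} (hpq : p * q = p + q) (hq : 2 < q)
    (hN : 0 < N) (hx : 0 ≤ x) :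
    ENNReal.ofReal (x ^ 2) * ∫⁻ t in Set.Ioi 0,
        {t : ℝ | t * x ^ (p - 1) ≤ 2 * N ^ p}.indicator
          (fun t => ENNReal.ofReal (4 * t ^ (q - 3))) t
      ≤ ENNReal.ofReal (4 * 2 ^ (q - 2) / (q - 2) * N ^ (p * (q - 2)))
        * ENNReal.ofReal (x ^ p) := by
  rcases hx.eq_or_lt with rfl | hx
  · simp
  set τ : ℝ := 2 * N ^ p * x ^ (1 - p) with hτ
  have hτ0 : 0 < τ := by positivity
  have hset : {t : ℝ | t * x ^ (p - 1) ≤ 2 * N ^ p} = Set.Iic τ := by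
    ext t
    have h1 : x ^ (1 - p) = (x ^ (p - 1))⁻¹ := by rw [← Real.rpow_neg hx.le]; congr 1; ring
    rw [Set.mem_ofPred_eq, Set.mem_Iic, hτ, h1, ← div_eq_mul_inv, le_div_iff₀ (by positivity)]
  rw [hset, lintegral_indicator measurableSet_Iic, Measure.restrict_restrict measurableSet_Iic,
    Set.inter_comm, Set.Ioi_inter_Iic]
  have h4 : ∀ t : ℝ, ENNReal.ofReal (4 * t ^ (q - 3))
      = ENNReal.ofReal 4 * ENNReal.ofReal (t ^ (q - 3)) :=
    fun t => ENNReal.ofReal_mul (by norm_num)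
  simp only [h4]
  rw [lintegral_const_mul _ (by fun_prop), lintegral_Ioc_zero_rpow (by linarith) hτ0.le,
    ← ENNReal.ofReal_mul (by norm_num), ← ENNReal.ofReal_mul (by positivity),
    ← ENNReal.ofReal_mul (by have : 0 < q - 2 := by linarith
                             positivity)]
  refine le_of_eq (congrArg ENNReal.ofReal ?_)
  have h5 : q - 3 + 1 = q - 2 := by ring
  have h6 : x ^ p = x ^ 2 * x ^ ((1 - p) * (q - 2)) := by
    rw [← Real.rpow_natCast, ← Real.rpow_add hx]
    congr 1
    push_cast
    linarith
  rw [h5, hτ, Real.mul_rpow (by positivity) (by positivity),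
    Real.mul_rpow (by positivity) (by positivity), ← Real.rpow_mul hN.le, ← Real.rpow_mul hx.le, h6]
  ring

/-- The real-variable core of Marcinkiewicz's theorem: a weak-type bound at every height `t` by the
`L²` norm of a truncation of `g` depending on `t` sums up to a strong bound. Here `N` is the `L^p`
norm of `g`. The sum over `i` is written as an integral over the distribution function, and the
order of integration in height and space is exchanged. -/
theorem tsum_rpow_le_of_truncation {α ι : Type*} [MeasurableSpace α] {μ : Measure α} [SFinite μ]
    [MeasurableSpace ι] [DiscreteMeasurableSpace ι] {p q N : ℝ} (hpq : p * q = p + q) (hq : 2 < q)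
    (hN : 0 < N) {a : ι → ℝ} (ha : ∀ i, 0 ≤ a i) {g : α → ℝ} (hg : Measurable g)
    (hg0 : ∀ x, 0 ≤ g x) (hgN : ∫⁻ x, ENNReal.ofReal (g x ^ p) ∂μ = ENNReal.ofReal (N ^ p))
    (h : ∀ t : ℝ, 0 < t → Measure.count {i | t < a i} * ENNReal.ofReal (t ^ 2 / 4)
      ≤ ∫⁻ x in {x | t * g x ^ (p - 1) ≤ 2 * N ^ p}, ENNReal.ofReal (g x ^ 2) ∂μ) :
    ∑' i, ENNReal.ofReal (a i ^ q) ≤ ENNReal.ofReal (interpolationConst q * N ^ q) := by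
  have hq2 : 0 < q - 2 := by linarith
  have hS : MeasurableSet {z : ℝ × α | z.1 * g z.2 ^ (p - 1) ≤ 2 * N ^ p} :=
    measurableSet_le (by fun_prop) measurable_const
  have hSt : ∀ t : ℝ, MeasurableSet {x | t * g x ^ (p - 1) ≤ 2 * N ^ p} := fun t =>
    measurableSet_le (by fun_prop) measurable_const
  set F : ℝ → α → ℝ≥0∞ := fun t x => {z : ℝ × α | z.1 * g z.2 ^ (p - 1) ≤ 2 * N ^ p}.indicator
    (fun z => ENNReal.ofReal (4 * z.1 ^ (q - 3)) * ENNReal.ofReal (g z.2 ^ 2)) (t, x) with hF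
  have hFm : Measurable (Function.uncurry F) := by
    refine Measurable.indicator ?_ hS
    fun_prop
  calc ∑' i, ENNReal.ofReal (a i ^ q)
      = ∫⁻ i, ENNReal.ofReal (a i ^ q) ∂Measure.count := (lintegral_count _).symm
    _ = ENNReal.ofReal q * ∫⁻ t in Set.Ioi 0,
          Measure.count {i | t < a i} * ENNReal.ofReal (t ^ (q - 1)) :=
        lintegral_rpow_eq_lintegral_meas_lt_mul _ (Filter.Eventually.of_forall ha)
          (Measurable.of_discrete).aemeasurable (by linarith)
    _ ≤ ENNReal.ofReal q * ∫⁻ t in Set.Ioi 0, ∫⁻ x, F t x ∂μ := by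
        gcongr ENNReal.ofReal q * ?_
        refine setLIntegral_mono' measurableSet_Ioi fun t (ht : 0 < t) => ?_
        have h1 : t ^ (q - 1) = t ^ 2 / 4 * (4 * t ^ (q - 3)) := by
          have : t ^ (q - 1) = t ^ 2 * t ^ (q - 3) := by
            rw [← Real.rpow_natCast, ← Real.rpow_add ht]
            congr 1
            push_cast
            ring
          rw [this]
          ring
        rw [h1, ENNReal.ofReal_mul (by positivity), ← mul_assoc]
        refine (mul_le_mul_left (h t ht) _).trans_eq ?_
        rw [mul_comm, ← lintegral_const_mul _ (by fun_prop), ← lintegral_indicator (hSt t)]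
        rfl
    _ = ENNReal.ofReal q * ∫⁻ x, (∫⁻ t in Set.Ioi 0, F t x) ∂μ := by
        rw [lintegral_lintegral_swap hFm.aemeasurable]
    _ ≤ ENNReal.ofReal q * ∫⁻ x,
          ENNReal.ofReal (4 * 2 ^ (q - 2) / (q - 2) * N ^ (p * (q - 2)))
            * ENNReal.ofReal (g x ^ p) ∂μ := by
        gcongr ENNReal.ofReal q * ?_
        refine lintegral_mono fun x => ?_
        refine le_trans (le_of_eq ?_) (sq_mul_lintegral_truncation hpq hq hN (hg0 x))
        have hSx : MeasurableSet {t : ℝ | t * g x ^ (p - 1) ≤ 2 * N ^ p} :=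
          measurableSet_le (by fun_prop) measurable_const
        rw [← lintegral_const_mul _ (Measurable.indicator (by fun_prop) hSx)]
        refine lintegral_congr fun t => ?_
        by_cases ht : t * g x ^ (p - 1) ≤ 2 * N ^ p
        · have h1 : (t, x) ∈ {z : ℝ × α | z.1 * g z.2 ^ (p - 1) ≤ 2 * N ^ p} := ht
          have h2 : t ∈ {t : ℝ | t * g x ^ (p - 1) ≤ 2 * N ^ p} := ht
          rw [hF]
          simp only
          rw [Set.indicator_of_mem h1, Set.indicator_of_mem h2, mul_comm]
        · simp [F, ht]
    _ = ENNReal.ofReal (interpolationConst q * N ^ q) := by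
        have h2 : N ^ q = N ^ (p * (q - 2)) * N ^ p := by
          rw [← Real.rpow_add hN]
          congr 1
          linarith
        rw [lintegral_const_mul _ (by fun_prop), hgN, ← ENNReal.ofReal_mul (by positivity),
          ← ENNReal.ofReal_mul (by linarith), interpolationConst, h2]
        congr 1
        ring

/-- Chebyshev's inequality for the counting measure. -/
theorem count_mul_le_tsum {ι : Type*} [MeasurableSpace ι] [DiscreteMeasurableSpace ι] {a c : ι → ℝ}
    {t : ℝ} (h : ∀ i, t < a i → t / 2 ≤ c i) (ht : 0 < t) :
    Measure.count {i | t < a i} * ENNReal.ofReal (t ^ 2 / 4)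
      ≤ ∑' i, ENNReal.ofReal (c i ^ 2) := by
  rw [← lintegral_count, mul_comm]
  refine le_trans ?_ (mul_meas_ge_le_lintegral Measurable.of_discrete (ENNReal.ofReal (t ^ 2 / 4)))
  gcongr with i
  intro hi
  refine ENNReal.ofReal_le_ofReal ?_
  nlinarith [h i hi]

/-- At height `t` the function is split according to whether `t |f| ^ (p - 1)` exceeds `2 ‖f‖_p ^ p`.
The large part has `L¹` norm at most `t / 2`, so whenever `‖A (b i)‖ > t` the small part contributes
at least `t / 2`, and the Hilbert–Schmidt bound for it limits the number of such `i`. -/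
theorem IsAlphaOp.tsum_norm_rpow_le {p q : ℝ} (hp1 : 1 < p) (hp2 : p ≤ 2) (hpq : p * q = p + q)
    (hq : 2 < q) {f : ℝ × ℝ → ℂ} (hf : MemLp f (ENNReal.ofReal p)) {A : L2 →L[ℂ] L2}
    (hA : IsAlphaOp f A) {ι : Type*} (b : HilbertBasis ι ℂ L2) :
    ∑' i, ENNReal.ofReal (‖A (b i)‖ ^ q)
      ≤ ENNReal.ofReal (interpolationConst q) * eLpNorm f (ENNReal.ofReal p) ^ q := by
  wlog hfm : StronglyMeasurable f generalizing f
  · have h := hf.1.ae_eq_mk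
    rw [eLpNorm_congr_ae h]
    exact this (hf.ae_eq h) (hA.congr h) hf.1.stronglyMeasurable_mk
  have hp0 : 0 < p := by linarith
  have hP1 : (1 : ℝ≥0∞) ≤ ENNReal.ofReal p := by simpa using hp1.le
  have hP2 : ENNReal.ofReal p ≤ 2 := by simpa using ENNReal.ofReal_le_ofReal hp2
  set N : ℝ := (eLpNorm f (ENNReal.ofReal p)).toReal with hNdef
  have hNe : eLpNorm f (ENNReal.ofReal p) = ENNReal.ofReal N := (ENNReal.ofReal_toReal hf.2.ne).symm
  have hN0 : 0 ≤ N := ENNReal.toReal_nonneg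
  rcases hN0.eq_or_lt with hN | hN
  · have hA0 : A = 0 := by
      have := hA.norm_le hP1 hP2 hf
      rw [← hNdef, ← hN] at this
      exact norm_le_zero_iff.1 this
    simp [hA0, Real.zero_rpow (by linarith : q ≠ 0)]
  have hgN : ∫⁻ z, ENNReal.ofReal (‖f z‖ ^ p) = ENNReal.ofReal (N ^ p) := by
    have h := eLpNorm_eq_lintegral_rpow_enorm_toReal (f := f) (μ := volume)
      (p := ENNReal.ofReal p) (by simpa using hp0) ENNReal.ofReal_ne_top
    rw [ENNReal.toReal_ofReal hp0.le, hNe] at h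
    rw [← ENNReal.ofReal_rpow_of_nonneg hN0 hp0.le, h, ← ENNReal.rpow_mul,
      one_div_mul_cancel hp0.ne', ENNReal.rpow_one]
    refine lintegral_congr fun z => ?_
    rw [← ENNReal.ofReal_rpow_of_nonneg (norm_nonneg _) hp0.le, ofReal_norm]
  let _ : MeasurableSpace ι := ⊤
  have hK : 0 ≤ interpolationConst q := by
    have : 0 < q - 2 := by linarith
    unfold interpolationConst
    positivity
  rw [hNe, ENNReal.ofReal_rpow_of_nonneg hN0 (by linarith), ← ENNReal.ofReal_mul hK]
  refine tsum_rpow_le_of_truncation hpq hq hN (fun i => norm_nonneg _)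
    hfm.measurable.norm (fun z => norm_nonneg _) hgN fun t ht => ?_
  set S : Set (ℝ × ℝ) := {z | t * ‖f z‖ ^ (p - 1) ≤ 2 * N ^ p} with hSdef
  have hS : MeasurableSet S := by
    have := hfm.measurable.norm
    exact measurableSet_le (by fun_prop) measurable_const
  have hsq : ∫⁻ z in S, ENNReal.ofReal (‖f z‖ ^ 2) = eLpNorm (S.indicator f) 2 ^ 2 := by
    rw [eLpNorm_two_sq, ← lintegral_indicator hS]
    refine lintegral_congr fun z => ?_
    by_cases hz : z ∈ S <;> simp [hz, ENNReal.ofReal_pow]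
  -- The right-hand side is infinite if the small part is not in `L²`.
  by_cases htop : eLpNorm (S.indicator f) 2 = ∞
  · rw [hsq, htop]
    simp
  have hf2 : MemLp (S.indicator f) 2 :=
    ⟨(hfm.indicator hS).aestronglyMeasurable, lt_top_iff_ne_top.2 htop⟩
  have hle : eLpNorm (Sᶜ.indicator f) 1 ≤ ENNReal.ofReal (t / 2) := by
    rw [eLpNorm_one_eq_lintegral_enorm]
    calc ∫⁻ z, ‖Sᶜ.indicator f z‖ₑ
        ≤ ∫⁻ z, ENNReal.ofReal (t / (2 * N ^ p)) * ENNReal.ofReal (‖f z‖ ^ p) := by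
          refine lintegral_mono fun z => ?_
          by_cases hz : z ∈ S
          · simp [hz]
          · have h1 : Sᶜ.indicator f z = f z := by simp [hz]
            simp only [h1]
            rw [← ofReal_norm, ← ENNReal.ofReal_mul (by positivity)]
            refine ENNReal.ofReal_le_ofReal ?_
            have h2 : 2 * N ^ p < t * ‖f z‖ ^ (p - 1) := not_le.1 hz
            have h3 : ‖f z‖ ^ p = ‖f z‖ ^ (p - 1) * ‖f z‖ := by
              rw [← Real.rpow_add_one' (norm_nonneg _) (by linarith)]
              congr 1
              ring
            rw [div_mul_eq_mul_div, le_div_iff₀ (by positivity), h3]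
            nlinarith [mul_le_mul_of_nonneg_right h2.le (norm_nonneg (f z))]
      _ = ENNReal.ofReal (t / 2) := by
          have := hfm.measurable.norm
          rw [lintegral_const_mul _ (by fun_prop), hgN, ← ENNReal.ofReal_mul (by positivity)]
          congr 1
          have : N ^ p ≠ 0 := by positivity
          field_simp
  have hf1 : MemLp (Sᶜ.indicator f) 1 :=
    ⟨(hfm.indicator hS.compl).aestronglyMeasurable, hle.trans_lt ENNReal.ofReal_lt_top⟩
  have hA1 := isAlphaOp_inverseAlpha (memLp_one_iff_integrable.1 hf1)
  set A₁ := inverseAlpha _ (memLp_one_iff_integrable.1 hf1)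
  have hA1n : ‖A₁‖ ≤ t / 2 := (hA1.norm_le le_rfl (by norm_num) hf1).trans
    (ENNReal.toReal_le_of_le_ofReal (by positivity) hle)
  have hA2 : IsAlphaOp (S.indicator f) (A - A₁) := by
    have h := hA.sub hP1 hP2 le_rfl (by norm_num) hf hf1 hA1
    rwa [Set.indicator_compl, sub_sub_cancel] at h
  rw [hsq]
  refine (count_mul_le_tsum (c := fun i => ‖(A - A₁) (b i)‖) (fun i hi => ?_) ht).trans
    (hA2.tsum_norm_sq_le hf2 b)
  have h1 : ‖A₁ (b i)‖ ≤ t / 2 := by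
    have := A₁.le_of_opNorm_le hA1n (b i)
    rwa [b.orthonormal.norm_eq_one, mul_one] at this
  have h2 := norm_sub_norm_le (A (b i)) (A₁ (b i))
  rw [sub_apply]
  linarith

end Interpolation

/-- The Hilbert–Schmidt bound for `p = 2` and the interpolated bound for `1 < p < 2`. -/
theorem IsAlphaOp.exists_tsum_norm_rpow_le {p q : ℝ≥0∞} (hp1 : 1 < p) (hp2 : p ≤ 2)
    (hpq : p⁻¹ + q⁻¹ = 1) :
    ∃ K : ℝ≥0, ∀ {f : ℝ × ℝ → ℂ}, MemLp f p → ∀ {A : L2 →L[ℂ] L2}, IsAlphaOp f A →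
      ∀ {ι : Type} (b : HilbertBasis ι ℂ L2),
        ∑' i, ENNReal.ofReal (‖A (b i)‖ ^ q.toReal) ≤ K * eLpNorm f p ^ q.toReal := by
  rcases hp2.eq_or_lt with rfl | hp2
  · have hq : q = 2 := by
      rw [← ENNReal.inv_two_add_inv_two] at hpq
      exact inv_injective ((ENNReal.add_right_inj (by norm_num)).1 hpq)
    subst hq
    exact ⟨1, fun hf _ hA _ b => by simpa using hA.tsum_norm_sq_le hf b⟩
  have hpt : p ≠ ∞ := hp2.ne_top
  have hP1 : 1 < p.toReal := by simpa using (ENNReal.toReal_lt_toReal (by norm_num) hpt).2 hp1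
  have hP2 : p.toReal < 2 := by simpa using (ENNReal.toReal_lt_toReal hpt (by norm_num)).2 hp2
  have hpinv : p⁻¹ ≠ ∞ := ENNReal.inv_ne_top.2 (zero_lt_one.trans hp1).ne'
  have hqinv : q⁻¹ ≠ ∞ := by
    intro h
    simp [h] at hpq
  have hsum : p.toReal⁻¹ + q.toReal⁻¹ = 1 := by
    rw [← ENNReal.toReal_inv, ← ENNReal.toReal_inv, ← ENNReal.toReal_add hpinv hqinv, hpq,
      ENNReal.toReal_one]
  have hQ0 : q.toReal ≠ 0 := by
    intro h
    rw [h, inv_zero, add_zero, inv_eq_one] at hsum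
    linarith
  have hmul : p.toReal * q.toReal = p.toReal + q.toReal := by
    field_simp at hsum
    linarith
  have hQ : 2 < q.toReal := by
    have h1 : (p.toReal - 1) * q.toReal = p.toReal := by linarith
    have h2 : 0 < q.toReal := by
      by_contra h
      nlinarith
    nlinarith
  refine ⟨(interpolationConst q.toReal).toNNReal, fun {f} hf A hA ι b => ?_⟩
  rw [← ENNReal.ofReal_toReal hpt] at hf
  have := hA.tsum_norm_rpow_le hP1 hP2.le hmul hQ hf b
  rwa [ENNReal.ofReal_toReal hpt] at this

end AlphaTransform

end

theorem theorem9p1 (p q : ℝ≥0∞) (hp1 : 1 ≤ p) (hp2 : p ≤ 2) (hpq : p⁻¹ + q⁻¹ = 1) :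
    ∃ Θp : Lp ℂ p (volume : Measure (ℝ × ℝ)) →ₗ[ℂ] (AlphaTransform.L2 →L[ℂ] AlphaTransform.L2),
      (∀ (f : Lp ℂ p (volume : Measure (ℝ × ℝ))) (hf : Integrable f),
        Θp f = AlphaTransform.inverseAlpha f hf) ∧
      (∀ f, AlphaTransform.MemSchatten q (Θp f)) ∧
      ∃ C : ℝ≥0, ∀ f : Lp ℂ p (volume : Measure (ℝ × ℝ)),
        AlphaTransform.schattenNorm q (Θp f) ≤ C * eLpNorm f p volume := by
  open AlphaTransform in
  choose Θ hΘ using fun f : Lp ℂ p (volume : Measure (ℝ × ℝ)) =>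
    exists_isAlphaOp hp1 hp2 (Lp.memLp f)
  let Θp : Lp ℂ p (volume : Measure (ℝ × ℝ)) →ₗ[ℂ] (L2 →L[ℂ] L2) :=
    { toFun := Θ
      map_add' := fun f g => (hΘ (f + g)).unique
        ((hΘ f).add hp1 hp2 hp1 hp2 (Lp.memLp f) (Lp.memLp g) (hΘ g)) (Lp.coeFn_add f g)
      map_smul' := fun c f => (hΘ (c • f)).unique ((hΘ f).smul c) (Lp.coeFn_smul c f) }
  have hcomp : ∀ f, IsCompactOperator (Θp f) := fun f =>
    (hΘ f).isCompactOperator hp1 hp2 (Lp.memLp f)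
  have hinv : ∀ (f : Lp ℂ p (volume : Measure (ℝ × ℝ))) (hf : Integrable f),
      Θp f = inverseAlpha f hf := fun f hf =>
    (hΘ f).unique (isAlphaOp_inverseAlpha hf) (Filter.EventuallyEq.refl _ _)
  rcases hp1.eq_or_lt with rfl | hp1'
  · have hq : q = ∞ := by
      rw [inv_one] at hpq
      have : (1 : ℝ≥0∞) + q⁻¹ = 1 + 0 := by rw [hpq, add_zero]
      exact ENNReal.inv_eq_zero.1 ((ENNReal.add_right_inj (by norm_num)).1 this)
    subst hq
    refine ⟨Θp, hinv, fun f => ?_, 1, fun f => ?_⟩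
    · rw [MemSchatten, if_pos rfl]
      exact hcomp f
    · rw [schattenNorm, if_pos rfl, ENNReal.coe_one, one_mul, ← ofReal_norm]
      exact ENNReal.ofReal_le_of_le_toReal ((hΘ f).norm_le hp1 hp2 (Lp.memLp f))
  · have hq : q ≠ ∞ := by
      rintro rfl
      rw [ENNReal.inv_top, add_zero, ENNReal.inv_eq_one] at hpq
      exact hp1'.ne' hpq
    have hq0 : 0 < q.toReal := ENNReal.toReal_pos
      (two_pos.trans_le (two_le_of_inv_add_inv hp2 hpq)).ne' hq
    obtain ⟨K, hK⟩ := IsAlphaOp.exists_tsum_norm_rpow_le hp1' hp2 hpq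
    have hbound : ∀ f : Lp ℂ p (volume : Measure (ℝ × ℝ)),
        schattenNorm q (Θp f) ≤ (K ^ (1 / q.toReal) : ℝ≥0) * eLpNorm f p volume := by
      intro f
      obtain ⟨ι, b, hb⟩ := exists_schattenNorm_eq_tsum (hcomp f) hq
      rw [hb]
      refine (ENNReal.rpow_le_rpow (hK (Lp.memLp f) (hΘ f) b) (by positivity)).trans_eq ?_
      rw [ENNReal.mul_rpow_of_nonneg _ _ (by positivity), ← ENNReal.rpow_mul,
        mul_one_div_cancel hq0.ne', ENNReal.rpow_one,
        ENNReal.coe_rpow_of_nonneg _ (by positivity)]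
    refine ⟨Θp, hinv, fun f => ?_, _, hbound⟩
    rw [MemSchatten, if_neg hq]
    exact (hbound f).trans_lt (by finiteness [(Lp.eLpNorm_lt_top f).ne])
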